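/- Let $(\Sigma_+,\Sigma_-,N_1,N_2,N_3):\mathbb{R}\to\mathbb{R}^5$ be a solution, with time variable $\tau$ and $'=d/d\tau$, of the Wainwright–Hsu form of Einstein's vacuum equations \begin{align*} N_1' &= (q-4\Sigma_+)N_1,\\ N_2' &= (q+2\Sigma_+ +2\sqrt{3}\,\Sigma_-)N_2,\\ N_3' &= (q+2\Sigma_+ -2\sqrt{3}\,\Sigma_-)N_3,\\ \Sigma_+' &= -(2-q)\Sigma_+-3S_+,\\ \Sigma_-' &= -(2-q)\Sigma_--3S_-, \end{align*} where $$q=2(\Sigma_+^2+\Sigma_-^2),\quad S_+=\tfrac12\big[(N_2-N_3)^2-N_1(2N_1-N_2-N_3)\big],\quad S_-=\tfrac{\sqrt3}{2}(N_3-N_2)(N_1-N_2-N_3),$$ subject to the Hamiltonian constraint $$\Sigma_+^2+\Sigma_-^2+\tfrac34\big[N_1^2+N_2^2+N_3^2-2(N_1N_2+N_2N_3+N_1N_3)\big]=1 .$$ Assume that the solution is of Bianchi type VIII with $N_1<0$ and $N_2,N_3>0$ (the signs of the $N_i$ are preserved by the equations, so it is enough to require this at one time $\tau_0$). Then $$\lim_{\tau\to\infty}N_1=0,\qquad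 \lim_{\tau\to\infty}N_2=\infty,\qquad \lim_{\tau\to\infty}N_3=\infty .$$ Furthermore $$\lim_{\tau\to\infty}\Sigma_+=\tfrac12,\qquad \lim_{\tau\to\infty}\Sigma_-=0,$$ and $$\lim_{\tau\to\infty}N_1(N_2+N_3)=-\tfrac12,\qquad \lim_{\tau\to\infty}(N_2-N_3)=0 .$$ -/

import Mathlib

open Filter Topology

noncomputable section

/-- The deceleration parameter `q = 2 (Σ₊² + Σ₋²)` of the vacuum equations. -/
def whQ (Sp Sm : ℝ) : ℝ := 2 * (Sp ^ 2 + Sm ^ 2)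

/-- `S₊ = ½ [(N₂ - N₃)² - N₁ (2 N₁ - N₂ - N₃)]`. -/
def whSPlus (N1 N2 N3 : ℝ) : ℝ :=
  (1 / 2) * ((N2 - N3) ^ 2 - N1 * (2 * N1 - N2 - N3))

/-- `S₋ = (√3 / 2) (N₃ - N₂) (N₁ - N₂ - N₃)`. -/
def whSMinus (N1 N2 N3 : ℝ) : ℝ :=
  (Real.sqrt 3 / 2) * (N3 - N2) * (N1 - N2 - N3)

/-- `(Σ₊, Σ₋, N₁, N₂, N₃)` is a solution on the whole real line of the Wainwright–Hsu form of the
vacuum Einstein equations for Bianchi class A, including the Hamiltonian constraint. -/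
structure IsWainwrightHsuSolution (Sp Sm N1 N2 N3 : ℝ → ℝ) : Prop where
  deriv_N1 : ∀ τ, HasDerivAt N1 ((whQ (Sp τ) (Sm τ) - 4 * Sp τ) * N1 τ) τ
  deriv_N2 : ∀ τ, HasDerivAt N2
    ((whQ (Sp τ) (Sm τ) + 2 * Sp τ + 2 * Real.sqrt 3 * Sm τ) * N2 τ) τ
  deriv_N3 : ∀ τ, HasDerivAt N3
    ((whQ (Sp τ) (Sm τ) + 2 * Sp τ - 2 * Real.sqrt 3 * Sm τ) * N3 τ) τ
  deriv_Sp : ∀ τ, HasDerivAt Sp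
    (-(2 - whQ (Sp τ) (Sm τ)) * Sp τ - 3 * whSPlus (N1 τ) (N2 τ) (N3 τ)) τ
  deriv_Sm : ∀ τ, HasDerivAt Sm
    (-(2 - whQ (Sp τ) (Sm τ)) * Sm τ - 3 * whSMinus (N1 τ) (N2 τ) (N3 τ)) τ
  constraint : ∀ τ, Sp τ ^ 2 + Sm τ ^ 2 + (3 / 4) * (N1 τ ^ 2 + N2 τ ^ 2 + N3 τ ^ 2
    - 2 * (N1 τ * N2 τ + N2 τ * N3 τ + N1 τ * N3 τ)) = 1

end

/-!
Put `n = -N₁ > 0`, `v = N₂ + N₃`, `U = (√3/2)(N₂ - N₃)`, `x = Σ₊`, `y = Σ₋`.  The constraint becomes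
`x² + y² + U² + ¾ n² + (3/2) n v = 1`, so everything except `v` is bounded.  The pair `(y, U)`
rotates with angular velocity about `3 v`, and `ψ = y U / v` satisfies
`ψ' = 3 (y² - U²) + O(1/v)`: adding multiples of `ψ` to a quantity replaces `y²` and `U²` in its
derivative by their average.

* Growth (`IsReducedSolution.exists_inv_v_le_exp`).  `P = n (v² - (4/3) U²) = 4 |N₁ N₂ N₃|` satisfies
  `P' = 3 q P` and `P ≤ (2/3) v`, so `v` is bounded below to the future.  The bounded function
  `x - ψ` has derivative at least `1/2 - C q`; hence `∫ q` grows at least linearly, and `P` and `v`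
  grow exponentially.  Therefore `n` and `ψ` decay exponentially.
* Monotone function (`IsReducedSolution.deriv_monotoneFun_ge`).  Up to exponentially small terms
  the function `log (n v) - 2 log (2 - x) - 2 ψ / (2 - x)` has derivative
  `2 (1 - 2 x)² / (2 - x) ≥ 0`.  It is bounded above, so it converges and `(1 - 2 x)²` is integrable;
  since `x` is Lipschitz, `x → 1/2`.  Consequently `n v`, and by the constraint `y² + U²`, converge.
* Vanishing of the oscillations.  If `y² + U² → E`, then `(x - ψ / 2)' → -(3/2) E`; as `x - ψ / 2`
  is bounded, `E = 0`.  The constraint then gives `n v → 1/2`.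
-/

/-! ### Real functions near infinity -/

/-- The solution of a scalar linear homogeneous equation is an exponential times its initial value;
in particular its sign never changes. -/
theorem eq_mul_exp_integral_of_hasDerivAt {f g : ℝ → ℝ} (hg : Continuous g)
    (hf : ∀ t, HasDerivAt f (g t * f t) t) (t₀ t : ℝ) :
    f t = f t₀ * Real.exp (∫ s in t₀..t, g s) := by
  have hG : ∀ t, HasDerivAt (fun t => ∫ s in t₀..t, g s) (g t) t := fun t =>
    intervalIntegral.integral_hasDerivAt_right (hg.intervalIntegrable _ _)
      (hg.stronglyMeasurableAtFilter _ _) hg.continuousAt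
  have hc : ∀ t, HasDerivAt (fun t => f t * Real.exp (-∫ s in t₀..t, g s)) 0 t := fun t => by
    refine ((hf t).mul (hG t).neg.exp).congr_deriv ?_
    ring
  have h := is_const_of_deriv_eq_zero (fun t => (hc t).differentiableAt)
    (fun t => (hc t).deriv) t t₀
  simp only [intervalIntegral.integral_same, neg_zero, Real.exp_zero, mul_one] at h
  rw [← h, mul_assoc, ← Real.exp_add, neg_add_cancel, Real.exp_zero, mul_one]

theorem mul_sub_le_sub_of_hasDerivAt {f f' : ℝ → ℝ} {a b c : ℝ} (hab : a ≤ b)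
    (hf : ∀ t, a ≤ t → HasDerivAt f (f' t) t) (hc : ∀ t, a ≤ t → t ≤ b → c ≤ f' t) :
    c * (b - a) ≤ f b - f a := by
  refine (convex_Icc a b).mul_sub_le_image_sub_of_le_deriv
    (fun t ht => (hf t ht.1).continuousAt.continuousWithinAt)
    (fun t ht => ?_) (fun t ht => ?_) a (Set.left_mem_Icc.2 hab) b (Set.right_mem_Icc.2 hab) hab
  · rw [interior_Icc] at ht
    exact (hf t ht.1.le).differentiableAt.differentiableWithinAt
  · rw [interior_Icc] at ht
    rw [(hf t ht.1.le).deriv]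
    exact hc t ht.1.le ht.2.le

theorem exists_tendsto_of_deriv_nonneg {f f' : ℝ → ℝ} {t₀ B : ℝ}
    (hf : ∀ t, t₀ ≤ t → HasDerivAt f (f' t) t) (h0 : ∀ t, t₀ ≤ t → 0 ≤ f' t)
    (hB : ∀ t, t₀ ≤ t → f t ≤ B) : ∃ l, Tendsto f atTop (𝓝 l) := by
  have hmono : Monotone fun t => f (max t t₀) := fun s t hst => by
    have := mul_sub_le_sub_of_hasDerivAt (c := 0) (max_le_max_right t₀ hst)
      (fun r hr => hf r ((le_max_right _ _).trans hr))
      (fun r hr _ => h0 r ((le_max_right _ _).trans hr))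
    simp only
    linarith
  refine ⟨_, (tendsto_atTop_ciSup hmono ⟨B, ?_⟩).congr' ?_⟩
  · rintro _ ⟨t, rfl⟩
    exact hB _ (le_max_right _ _)
  · filter_upwards [eventually_ge_atTop t₀] with t ht
    rw [max_eq_left ht]

/-- A form of Barbalat's lemma: if `R` converges and `R' ≥ k g²` with `g` Lipschitz, then `g → 0`. -/
theorem tendsto_zero_of_mul_sq_le_deriv {R R' g : ℝ → ℝ} {t₀ k L l : ℝ} (hk : 0 < k) (hL : 0 < L)
    (hR : ∀ t, t₀ ≤ t → HasDerivAt R (R' t) t) (hR' : ∀ t, t₀ ≤ t → k * g t ^ 2 ≤ R' t)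
    (hg : ∀ s t, t₀ ≤ s → s ≤ t → |g t - g s| ≤ L * (t - s)) (hl : Tendsto R atTop (𝓝 l)) :
    Tendsto g atTop (𝓝 0) := by
  rw [Metric.tendsto_nhds]
  intro ε hε
  -- on an interval of length `δ` the function `g` changes by at most `ε / 2`
  set δ := ε / (2 * L) with hδ
  have hδ0 : 0 < δ := by positivity
  have hLδ : L * δ = ε / 2 := by rw [hδ]; field_simp
  have hdiff : Tendsto (fun t => R (t + δ) - R t) atTop (𝓝 0) := by
    simpa using (hl.comp (tendsto_atTop_add_const_right _ δ tendsto_id)).sub hl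
  have hpos : 0 < k * (ε / 2) ^ 2 * δ := by positivity
  filter_upwards [hdiff.eventually_lt_const hpos, eventually_ge_atTop t₀] with t ht ht0
  rw [Real.dist_eq, sub_zero]
  by_contra! hge
  have := mul_sub_le_sub_of_hasDerivAt (c := k * (ε / 2) ^ 2) (by linarith : t ≤ t + δ)
    (fun s hs => hR s (ht0.trans hs)) (fun s hs hs' => by
      refine le_trans ?_ (hR' s (ht0.trans hs))
      have h1 := hg t s ht0 hs
      have h2 : L * (s - t) ≤ ε / 2 := by
        rw [← hLδ]
        exact mul_le_mul_of_nonneg_left (by linarith) hL.le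
      have h3 : ε / 2 ≤ |g s| := by
        have := abs_sub_abs_le_abs_sub (g t) (g s)
        rw [abs_sub_comm] at this
        linarith
      rw [← sq_abs (g s)]
      gcongr)
  rw [add_sub_cancel_left] at this
  linarith

theorem nonpos_of_tendsto_deriv_of_bddAbove {f f' : ℝ → ℝ} {t₀ B l : ℝ}
    (hf : ∀ t, t₀ ≤ t → HasDerivAt f (f' t) t) (hB : ∀ t, t₀ ≤ t → f t ≤ B)
    (hl : Tendsto f' atTop (𝓝 l)) : l ≤ 0 := by
  by_contra! hpos
  obtain ⟨T, hT⟩ := eventually_atTop.1 (hl.eventually_const_lt (half_lt_self hpos))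
  set a := max T t₀
  have ha : t₀ ≤ a := le_max_right _ _
  set d := 2 / l * (B - f a + 1)
  have hd : 0 ≤ d := mul_nonneg (by positivity) (by linarith [hB a ha])
  have := mul_sub_le_sub_of_hasDerivAt (c := l / 2) (by linarith : a ≤ a + d)
    (fun s hs => hf s (ha.trans hs)) (fun s hs _ => (hT s ((le_max_left _ _).trans hs)).le)
  have e : l / 2 * (a + d - a) = B - f a + 1 := by
    simp only [d]
    field_simp
    ring
  linarith [hB (a + d) (by linarith)]

/-! ### The reduced system -/

/-- The type VIII equations in the variables `x = Σ₊`, `y = Σ₋`, `U = (√3/2)(N₂ - N₃)`, `n = -N₁`,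
`v = N₂ + N₃`.  The last field expresses `N₂ N₃ > 0`. -/
structure IsReducedSolution (x y U n v : ℝ → ℝ) : Prop where
  deriv_n : ∀ t, HasDerivAt n ((whQ (x t) (y t) - 4 * x t) * n t) t
  deriv_v : ∀ t, HasDerivAt v ((whQ (x t) (y t) + 2 * x t) * v t + 4 * y t * U t) t
  deriv_U : ∀ t, HasDerivAt U ((whQ (x t) (y t) + 2 * x t) * U t + 3 * y t * v t) t
  deriv_x : ∀ t, HasDerivAt x (-(2 - whQ (x t) (y t)) * x t - 2 * U t ^ 2
    + 3 / 2 * (n t * v t) + 3 * n t ^ 2) t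
  deriv_y : ∀ t, HasDerivAt y (-(2 - whQ (x t) (y t)) * y t - 3 * U t * (v t + n t)) t
  constraint : ∀ t, x t ^ 2 + y t ^ 2 + U t ^ 2 + 3 / 4 * n t ^ 2 + 3 / 2 * (n t * v t) = 1
  n_pos : ∀ t, 0 < n t
  v_pos : ∀ t, 0 < v t
  lt_v_sq : ∀ t, 4 / 3 * U t ^ 2 < v t ^ 2

/-- The correction `ψ = y U / v`, whose derivative is `3 (y² - U²)` up to terms of order `1 / v`. -/
noncomputable def averagingCorrection (y U v : ℝ → ℝ) (t : ℝ) : ℝ := y t * U t / v t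

/-- `P = n (v² - (4/3) U²)`, which equals `4 |N₁ N₂ N₃|`. -/
noncomputable def volumeFun (U n v : ℝ → ℝ) (t : ℝ) : ℝ := n t * (v t ^ 2 - 4 / 3 * U t ^ 2)

/-- The function `log (n v) - 2 log (2 - x) - 2 ψ / (2 - x)`, which is increasing up to exponentially
small terms. -/
noncomputable def monotoneFun (x y U n v : ℝ → ℝ) (t : ℝ) : ℝ :=
  Real.log (n t * v t) - 2 * Real.log (2 - x t) - 2 * averagingCorrection y U v t / (2 - x t)

namespace IsReducedSolution

variable {x y U n v : ℝ → ℝ}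

theorem nv_pos (h : IsReducedSolution x y U n v) (t : ℝ) : 0 < n t * v t :=
  mul_pos (h.n_pos t) (h.v_pos t)

theorem nv_le (h : IsReducedSolution x y U n v) (t : ℝ) : n t * v t ≤ 2 / 3 := by
  nlinarith [h.constraint t, sq_nonneg (x t), sq_nonneg (y t), sq_nonneg (U t), sq_nonneg (n t)]

theorem sq_add_sq_add_sq_le (h : IsReducedSolution x y U n v) (t : ℝ) :
    x t ^ 2 + y t ^ 2 + U t ^ 2 ≤ 1 := by
  nlinarith [h.constraint t, h.nv_pos t, sq_nonneg (n t)]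

theorem abs_x_le (h : IsReducedSolution x y U n v) (t : ℝ) : |x t| ≤ 1 :=
  abs_le_one_iff_mul_self_le_one.2
    (by nlinarith [h.sq_add_sq_add_sq_le t, sq_nonneg (y t), sq_nonneg (U t)])

theorem abs_U_le (h : IsReducedSolution x y U n v) (t : ℝ) : |U t| ≤ 1 :=
  abs_le_one_iff_mul_self_le_one.2
    (by nlinarith [h.sq_add_sq_add_sq_le t, sq_nonneg (y t), sq_nonneg (x t)])

theorem abs_y_le (h : IsReducedSolution x y U n v) (t : ℝ) : |y t| ≤ 1 :=
  abs_le_one_iff_mul_self_le_one.2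
    (by nlinarith [h.sq_add_sq_add_sq_le t, sq_nonneg (U t), sq_nonneg (x t)])

theorem whQ_nonneg (x y : ℝ) : 0 ≤ whQ x y := by
  unfold whQ
  positivity

theorem whQ_le (h : IsReducedSolution x y U n v) (t : ℝ) : whQ (x t) (y t) ≤ 2 := by
  unfold whQ
  nlinarith [h.sq_add_sq_add_sq_le t, sq_nonneg (U t)]

/-- The constraint is used to eliminate `n v`. -/
theorem deriv_x' (h : IsReducedSolution x y U n v) (t : ℝ) :
    HasDerivAt x (1 - x t ^ 2 - y t ^ 2 - 3 * U t ^ 2 + 9 / 4 * n t ^ 2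
      - (2 - whQ (x t) (y t)) * x t) t := by
  refine (h.deriv_x t).congr_deriv ?_
  linear_combination h.constraint t

theorem abs_deriv_x_le (h : IsReducedSolution x y U n v) (t : ℝ) :
    |1 - x t ^ 2 - y t ^ 2 - 3 * U t ^ 2 + 9 / 4 * n t ^ 2
      - (2 - whQ (x t) (y t)) * x t| ≤ 9 := by
  have h1 : |(2 - whQ (x t) (y t)) * x t| ≤ 2 := by
    rw [abs_mul, abs_of_nonneg (by linarith [h.whQ_le t])]
    nlinarith [h.whQ_le t, h.abs_x_le t, whQ_nonneg (x t) (y t), abs_nonneg (x t)]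
  obtain ⟨h2, h3⟩ := abs_le.1 h1
  have h4 := h.constraint t
  have h5 := h.nv_pos t
  rw [abs_le]
  constructor <;>
    nlinarith [sq_nonneg (x t), sq_nonneg (y t), sq_nonneg (U t), sq_nonneg (n t)]

theorem volumeFun_pos (h : IsReducedSolution x y U n v) (t : ℝ) : 0 < volumeFun U n v t :=
  mul_pos (h.n_pos t) (sub_pos.2 (h.lt_v_sq t))

theorem volumeFun_le (h : IsReducedSolution x y U n v) (t : ℝ) :
    volumeFun U n v t ≤ 2 / 3 * v t := by
  unfold volumeFun
  nlinarith [mul_le_mul_of_nonneg_right (h.nv_le t) (h.v_pos t).le,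
    mul_nonneg (h.n_pos t).le (sq_nonneg (U t))]

theorem deriv_log_volumeFun (h : IsReducedSolution x y U n v) (t : ℝ) :
    HasDerivAt (fun t => Real.log (volumeFun U n v t)) (3 * whQ (x t) (y t)) t := by
  have h1 : HasDerivAt (volumeFun U n v) (3 * whQ (x t) (y t) * volumeFun U n v t) t := by
    refine ((h.deriv_n t).mul (((h.deriv_v t).pow 2).sub
      (((h.deriv_U t).pow 2).const_mul (4 / 3)))).congr_deriv ?_
    simp only [volumeFun, Pi.pow_apply, Pi.sub_apply]
    push_cast
    ring
  refine (h1.log (h.volumeFun_pos t).ne').congr_deriv ?_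
  field_simp [(h.volumeFun_pos t).ne']

theorem deriv_averagingCorrection (h : IsReducedSolution x y U n v) (t : ℝ) :
    HasDerivAt (averagingCorrection y U v)
      (averagingCorrection y U v t * (whQ (x t) (y t) - 2 - 4 * averagingCorrection y U v t)
        + 3 * (y t ^ 2 - U t ^ 2) - 3 * U t ^ 2 * (n t / v t)) t := by
  have hv := (h.v_pos t).ne'
  refine (((h.deriv_y t).mul (h.deriv_U t)).div (h.deriv_v t) hv).congr_deriv ?_
  simp only [averagingCorrection, Pi.mul_apply]
  field_simp
  ring

theorem abs_averagingCorrection_le (h : IsReducedSolution x y U n v) (t : ℝ) :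
    |averagingCorrection y U v t| ≤ 1 / v t := by
  rw [averagingCorrection, abs_div, abs_of_pos (h.v_pos t), abs_mul]
  gcongr
  · exact (h.v_pos t).le
  · exact mul_le_one₀ (h.abs_y_le t) (abs_nonneg _) (h.abs_U_le t)

theorem n_le (h : IsReducedSolution x y U n v) (t : ℝ) : n t ≤ 1 / v t := by
  rw [le_div_iff₀ (h.v_pos t)]
  linarith [h.nv_le t]

/-! ### Exponential growth of `v` -/

theorem log_volumeFun_mono (h : IsReducedSolution x y U n v) {s t : ℝ} (hst : s ≤ t) :
    Real.log (volumeFun U n v s) ≤ Real.log (volumeFun U n v t) := by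
  have := mul_sub_le_sub_of_hasDerivAt (c := 0) hst (fun r _ => h.deriv_log_volumeFun r)
    (fun r _ _ => mul_nonneg (by norm_num) (whQ_nonneg _ _))
  linarith

/-- `v` is bounded below to the future because `P` increases and `P ≤ (2/3) v`. -/
theorem exists_inv_v_le (h : IsReducedSolution x y U n v) (t₀ : ℝ) :
    ∃ k, 0 < k ∧ ∀ t, t₀ ≤ t → 1 / v t ≤ k := by
  have h0 := h.volumeFun_pos t₀
  refine ⟨1 / volumeFun U n v t₀, by positivity, fun t ht => ?_⟩
  have h1 := (Real.log_le_log_iff h0 (h.volumeFun_pos t)).1 (h.log_volumeFun_mono ht)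
  exact one_div_le_one_div_of_le h0 (by linarith [h.volumeFun_le t, h.v_pos t])

/-- The right-hand side is the derivative of `x - ψ`, which is thus at least `1/2` up to a multiple
of `q`. -/
theorem deriv_x_sub_averagingCorrection_ge (h : IsReducedSolution x y U n v) {k t : ℝ}
    (hk : 1 / v t ≤ k) :
    1 / 2 - (4 + 2 * k ^ 2 + k) * whQ (x t) (y t) ≤
      (1 - x t ^ 2 - y t ^ 2 - 3 * U t ^ 2 + 9 / 4 * n t ^ 2 - (2 - whQ (x t) (y t)) * x t) -
      (averagingCorrection y U v t * (whQ (x t) (y t) - 2 - 4 * averagingCorrection y U v t)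
        + 3 * (y t ^ 2 - U t ^ 2) - 3 * U t ^ 2 * (n t / v t)) := by
  have hq0 := whQ_nonneg (x t) (y t)
  have hqdef : whQ (x t) (y t) = 2 * (x t ^ 2 + y t ^ 2) := rfl
  have hv := h.v_pos t
  have hk0 : 0 < k := lt_of_lt_of_le (by positivity) hk
  have hψ : |averagingCorrection y U v t| ≤ k * |y t| := by
    rw [averagingCorrection, abs_div, abs_of_pos hv, abs_mul, div_eq_mul_one_div, mul_comm k]
    refine mul_le_mul ?_ hk (by positivity) (abs_nonneg _)
    exact mul_le_of_le_one_right (abs_nonneg _) (h.abs_U_le t)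
  have hψk : |averagingCorrection y U v t| ≤ k := (h.abs_averagingCorrection_le t).trans hk
  generalize averagingCorrection y U v t = ψ at *
  have hnv : 0 ≤ U t ^ 2 * (n t / v t) := by have := h.n_pos t; positivity
  have hψq : ψ * whQ (x t) (y t) ≤ k * whQ (x t) (y t) :=
    mul_le_mul_of_nonneg_right ((le_abs_self _).trans hψk) hq0
  have hxq : -whQ (x t) (y t) ≤ x t * whQ (x t) (y t) := by
    have := mul_le_mul_of_nonneg_right (abs_le.1 (h.abs_x_le t)).1 hq0
    linarith
  -- Young's inequality absorbs the linear terms in `x` and `y`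
  have hψ2 : -(1 / 4 + 4 * k ^ 2 * y t ^ 2) ≤ 2 * ψ := by
    have h1 := neg_abs_le ψ
    nlinarith [sq_nonneg (2 * (k * |y t|) - 1 / 2), sq_abs (y t)]
  have hx2 : 2 * x t ≤ 1 / 4 + 4 * x t ^ 2 := by nlinarith [sq_nonneg (2 * x t - 1 / 2)]
  nlinarith [sq_nonneg (n t), sq_nonneg ψ, sq_nonneg (x t), sq_nonneg (y t),
    mul_nonneg (sq_nonneg k) (sq_nonneg (x t))]

theorem exists_inv_v_le_exp (h : IsReducedSolution x y U n v) (t₀ : ℝ) :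
    ∃ c b, 0 < c ∧ 0 < b ∧ ∀ t, t₀ ≤ t → 1 / v t ≤ b * Real.exp (-c * t) := by
  obtain ⟨k, hk0, hk⟩ := h.exists_inv_v_le t₀
  set C := 4 + 2 * k ^ 2 + k with hC
  have hC0 : 0 < C := by positivity
  -- `A = (C / 3) log P + x - ψ` has derivative at least `1 / 2`
  set A : ℝ → ℝ := fun t => C / 3 * Real.log (volumeFun U n v t)
    + (x t - averagingCorrection y U v t) with hA
  have hbd : ∀ t, t₀ ≤ t → |x t - averagingCorrection y U v t| ≤ 1 + k := fun t ht =>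
    (abs_sub _ _).trans (add_le_add (h.abs_x_le t)
      ((h.abs_averagingCorrection_le t).trans (hk t ht)))
  have hgrow : ∀ t, t₀ ≤ t → 1 / 2 * (t - t₀) ≤ A t - A t₀ := fun t ht =>
    mul_sub_le_sub_of_hasDerivAt ht
      (fun s _ => ((h.deriv_log_volumeFun s).const_mul (C / 3)).add
        ((h.deriv_x' s).sub (h.deriv_averagingCorrection s)))
      (fun s hs _ => by
        have := h.deriv_x_sub_averagingCorrection_ge (hk s hs)
        simp only [← hC] at this
        linarith)
  refine ⟨3 / C / 2, Real.exp (3 / C * (t₀ / 2 - A t₀ + (1 + k))), by positivity,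
    Real.exp_pos _, fun t ht => ?_⟩
  have hP := h.volumeFun_pos t
  have h1 : 1 / v t ≤ 1 / volumeFun U n v t :=
    one_div_le_one_div_of_le hP (by linarith [h.volumeFun_le t, h.v_pos t])
  refine h1.trans ?_
  have h2 : 1 / volumeFun U n v t = Real.exp (-Real.log (volumeFun U n v t)) := by
    rw [Real.exp_neg, Real.exp_log hP, one_div]
  rw [h2, ← Real.exp_add, Real.exp_le_exp]
  have h3 := hgrow t ht
  have h4 := (abs_le.1 (hbd t ht)).2
  have h5 : t / 2 - t₀ / 2 + A t₀ - (1 + k) ≤ C / 3 * Real.log (volumeFun U n v t) := by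
    simp only [hA] at h3 ⊢
    linarith
  have h6 := mul_le_mul_of_nonneg_left h5 (by positivity : 0 ≤ 3 / C)
  have h7 : 3 / C * (C / 3 * Real.log (volumeFun U n v t)) = Real.log (volumeFun U n v t) := by
    field_simp
  rw [h7] at h6
  linarith

theorem tendsto_inv_v (h : IsReducedSolution x y U n v) :
    Tendsto (fun t => 1 / v t) atTop (𝓝 0) := by
  obtain ⟨c, b, hc, -, hb⟩ := h.exists_inv_v_le_exp 0
  refine squeeze_zero' (Eventually.of_forall fun t => (one_div_pos.2 (h.v_pos t)).le)
    ((eventually_ge_atTop 0).mono fun t ht => hb t ht) ?_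
  have : Tendsto (fun t : ℝ => Real.exp (-c * t)) atTop (𝓝 0) :=
    Real.tendsto_exp_atBot.comp (tendsto_id.const_mul_atTop_of_neg (neg_lt_zero.2 hc))
  simpa using this.const_mul b

theorem tendsto_v (h : IsReducedSolution x y U n v) : Tendsto v atTop atTop := by
  have h1 : Tendsto (fun t => 1 / v t) atTop (𝓝[>] 0) :=
    tendsto_nhdsWithin_iff.2 ⟨h.tendsto_inv_v,
      Eventually.of_forall fun t => one_div_pos.2 (h.v_pos t)⟩
  refine (tendsto_inv_nhdsGT_zero.comp h1).congr fun t => ?_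
  simp

theorem tendsto_n (h : IsReducedSolution x y U n v) : Tendsto n atTop (𝓝 0) :=
  squeeze_zero (fun t => (h.n_pos t).le) h.n_le h.tendsto_inv_v

theorem tendsto_averagingCorrection (h : IsReducedSolution x y U n v) :
    Tendsto (averagingCorrection y U v) atTop (𝓝 0) :=
  squeeze_zero_norm h.abs_averagingCorrection_le h.tendsto_inv_v

/-! ### The monotone function and convergence of `x` -/

theorem deriv_monotoneFun (h : IsReducedSolution x y U n v) (t : ℝ) :
    HasDerivAt (monotoneFun x y U n v)
      ((2 * (1 - 2 * x t) ^ 2 + 9 / 2 * n t ^ 2 + 6 * U t ^ 2 * (n t / v t)) / (2 - x t)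
        + 4 * averagingCorrection y U v t
        - 2 * averagingCorrection y U v t
          * (whQ (x t) (y t) - 2 - 4 * averagingCorrection y U v t) / (2 - x t)
        - 2 * averagingCorrection y U v t * (1 - x t ^ 2 - y t ^ 2 - 3 * U t ^ 2
          + 9 / 4 * n t ^ 2 - (2 - whQ (x t) (y t)) * x t) / (2 - x t) ^ 2) t := by
  have hv := (h.v_pos t).ne'
  have hn := (h.n_pos t).ne'
  have hx : 2 - x t ≠ 0 := by linarith [(abs_le.1 (h.abs_x_le t)).2]
  have hnv : HasDerivAt (fun t => n t * v t)
      ((2 * whQ (x t) (y t) - 2 * x t + 4 * averagingCorrection y U v t) * (n t * v t)) t := by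
    refine ((h.deriv_n t).mul (h.deriv_v t)).congr_deriv ?_
    simp only [averagingCorrection]
    field_simp
    ring
  have hlog : HasDerivAt (fun t => Real.log (n t * v t))
      (2 * whQ (x t) (y t) - 2 * x t + 4 * averagingCorrection y U v t) t := by
    refine (hnv.log (h.nv_pos t).ne').congr_deriv ?_
    field_simp
  have h2x := (h.deriv_x' t).const_sub 2
  refine ((hlog.sub ((h2x.log hx).const_mul 2)).sub
    (((h.deriv_averagingCorrection t).const_mul 2).div h2x hx)).congr_deriv ?_
  generalize averagingCorrection y U v t = ψ
  have hq : whQ (x t) (y t) = 2 * (x t ^ 2 + y t ^ 2) := rfl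
  rw [hq]
  generalize n t / v t = r
  field_simp
  ring

/-- The right-hand side is the derivative of `monotoneFun`; since `ψ` decays exponentially,
`monotoneFun` increases up to an integrable error. -/
theorem deriv_monotoneFun_ge (h : IsReducedSolution x y U n v) (t : ℝ) :
    2 / 3 * (1 - 2 * x t) ^ 2 - 26 * |averagingCorrection y U v t| ≤
      (2 * (1 - 2 * x t) ^ 2 + 9 / 2 * n t ^ 2 + 6 * U t ^ 2 * (n t / v t)) / (2 - x t)
        + 4 * averagingCorrection y U v t
        - 2 * averagingCorrection y U v t
          * (whQ (x t) (y t) - 2 - 4 * averagingCorrection y U v t) / (2 - x t)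
        - 2 * averagingCorrection y U v t * (1 - x t ^ 2 - y t ^ 2 - 3 * U t ^ 2
          + 9 / 4 * n t ^ 2 - (2 - whQ (x t) (y t)) * x t) / (2 - x t) ^ 2 := by
  obtain ⟨hx1, hx2⟩ := abs_le.1 (h.abs_x_le t)
  have hX := h.abs_deriv_x_le t
  generalize 1 - x t ^ 2 - y t ^ 2 - 3 * U t ^ 2 + 9 / 4 * n t ^ 2
    - (2 - whQ (x t) (y t)) * x t = X at *
  have hq0 := whQ_nonneg (x t) (y t)
  have hq2 := h.whQ_le t
  generalize averagingCorrection y U v t = ψ at *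
  generalize whQ (x t) (y t) = q at *
  have hn := h.n_pos t
  have hv := h.v_pos t
  have hd : 0 < 2 - x t := by linarith
  have hd1 : 1 ≤ 2 - x t := by linarith
  have e1 : 2 / 3 * (1 - 2 * x t) ^ 2 ≤
      (2 * (1 - 2 * x t) ^ 2 + 9 / 2 * n t ^ 2 + 6 * U t ^ 2 * (n t / v t)) / (2 - x t) := by
    rw [le_div_iff₀ hd]
    have : 0 ≤ 9 / 2 * n t ^ 2 + 6 * U t ^ 2 * (n t / v t) := by positivity
    nlinarith [mul_le_mul_of_nonneg_left (by linarith : 2 - x t ≤ 3) (sq_nonneg (1 - 2 * x t))]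
  have e2 : -(4 * |ψ|) ≤ 4 * ψ := by linarith [neg_abs_le ψ]
  -- the contribution `8 ψ² / (2 - x)` has the good sign
  have e3 : 2 * ψ * (q - 2 - 4 * ψ) / (2 - x t) ≤ 4 * |ψ| := by
    rw [div_le_iff₀ hd]
    have h1 : ψ * (q - 2) ≤ 2 * |ψ| := by
      nlinarith [neg_abs_le ψ, le_abs_self ψ, abs_nonneg ψ]
    nlinarith [sq_nonneg ψ, mul_le_mul_of_nonneg_left hd1 (abs_nonneg ψ)]
  have e4 : 2 * ψ * X / (2 - x t) ^ 2 ≤ 18 * |ψ| := by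
    have h1 : ψ * X ≤ |ψ| * 9 := (le_abs_self _).trans
      (by rw [abs_mul]; exact mul_le_mul_of_nonneg_left hX (abs_nonneg _))
    have h2 : (1 : ℝ) ≤ (2 - x t) ^ 2 := one_le_pow₀ hd1
    rw [div_le_iff₀ (by positivity)]
    nlinarith [mul_le_mul_of_nonneg_left h2 (abs_nonneg ψ)]
  linarith

theorem abs_x_sub_le (h : IsReducedSolution x y U n v) {s t : ℝ} (hst : s ≤ t) :
    |x t - x s| ≤ 9 * (t - s) := by
  have h1 := mul_sub_le_sub_of_hasDerivAt (c := -9) hst (fun r _ => h.deriv_x' r)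
    (fun r _ _ => (abs_le.1 (h.abs_deriv_x_le r)).1)
  have h2 := mul_sub_le_sub_of_hasDerivAt (c := -9) hst (fun r _ => (h.deriv_x' r).neg)
    (fun r _ _ => neg_le_neg (abs_le.1 (h.abs_deriv_x_le r)).2)
  simp only [Pi.neg_apply] at h2
  rw [abs_le]
  constructor <;> linarith

theorem tendsto_monotoneFun_and_x (h : IsReducedSolution x y U n v) :
    (∃ l, Tendsto (monotoneFun x y U n v) atTop (𝓝 l)) ∧ Tendsto x atTop (𝓝 (1 / 2)) := by
  obtain ⟨c, b, hc, hb0, hb⟩ := h.exists_inv_v_le_exp 0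
  -- subtracting an antiderivative of the error bound makes the function increasing
  set e : ℝ → ℝ := fun t => 26 * b / c * Real.exp (-c * t)
  have hde : ∀ t, HasDerivAt e (-(26 * (b * Real.exp (-c * t)))) t := fun t => by
    have h1 : HasDerivAt (fun t : ℝ => -c * t) (-c) t := by
      simpa using (hasDerivAt_id t).const_mul (-c)
    refine (h1.exp.const_mul (26 * b / c)).congr_deriv ?_
    field_simp
  have hexp : Tendsto (fun t : ℝ => Real.exp (-c * t)) atTop (𝓝 0) :=
    Real.tendsto_exp_atBot.comp (tendsto_id.const_mul_atTop_of_neg (neg_lt_zero.2 hc))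
  have hetend : Tendsto e atTop (𝓝 0) := by
    simpa only [mul_zero] using hexp.const_mul (26 * b / c)
  have hdR := fun t => (h.deriv_monotoneFun t).sub (hde t)
  have hR' := fun t (ht : 0 ≤ t) =>
    show 2 / 3 * (1 - 2 * x t) ^ 2 ≤ _ - -(26 * (b * Real.exp (-c * t))) from
      le_sub_iff_add_le.2 (le_trans
        (by linarith [(h.abs_averagingCorrection_le t).trans (hb t ht)])
        (h.deriv_monotoneFun_ge t))
  obtain ⟨l, hl⟩ := exists_tendsto_of_deriv_nonneg (t₀ := 0) (B := 2 * b) (fun t _ => hdR t)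
    (fun t ht => le_trans (by positivity) (hR' t ht)) (fun t ht => by
      have hx := (abs_le.1 (h.abs_x_le t)).2
      have h1 : Real.log (n t * v t) ≤ 0 :=
        Real.log_nonpos (h.nv_pos t).le (by linarith [h.nv_le t])
      have h2 : 0 ≤ Real.log (2 - x t) := Real.log_nonneg (by linarith)
      have h3 : 0 ≤ e t := by positivity
      have h4 : |averagingCorrection y U v t| ≤ b :=
        ((h.abs_averagingCorrection_le t).trans (hb t ht)).trans
          (mul_le_of_le_one_right hb0.le (Real.exp_le_one_iff.2 (by nlinarith)))
      have h5 : -(2 * b) ≤ 2 * averagingCorrection y U v t / (2 - x t) := by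
        rw [le_div_iff₀ (by linarith)]
        nlinarith [(abs_le.1 h4).1]
      simp only [Pi.sub_apply, monotoneFun]
      linarith)
  refine ⟨⟨l, by simpa using hl.add hetend⟩, ?_⟩
  have hg : Tendsto (fun t => 1 - 2 * x t) atTop (𝓝 0) :=
    tendsto_zero_of_mul_sq_le_deriv (t₀ := 0) (k := 2 / 3) (L := 18) (by norm_num) (by norm_num)
      (fun t _ => hdR t) hR' (fun s t _ hst => by
        have h1 := abs_le.1 (h.abs_x_sub_le hst)
        rw [abs_le]
        constructor <;> linarith [h1.1, h1.2]) hl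
  have := (hg.const_sub 1).div_const 2
  simpa using this

/-! ### Decay of the oscillations -/

theorem exists_tendsto_nv (h : IsReducedSolution x y U n v) :
    ∃ m, Tendsto (fun t => n t * v t) atTop (𝓝 m) := by
  obtain ⟨⟨l, hl⟩, hx⟩ := h.tendsto_monotoneFun_and_x
  have h2x : Tendsto (fun t => 2 - x t) atTop (𝓝 (2 - 1 / 2)) := hx.const_sub 2
  have hlog := (h2x.log (by norm_num)).const_mul 2
  have hcor := (h.tendsto_averagingCorrection.const_mul 2).div h2x (by norm_num)
  have hexp := ((Real.continuous_exp.tendsto _).comp ((hl.add hcor).add hlog))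
  refine ⟨_, hexp.congr fun t => ?_⟩
  simp only [Function.comp, monotoneFun, Pi.div_apply]
  rw [sub_add_cancel, sub_add_cancel, Real.exp_log (h.nv_pos t)]

/-- The limit `E` of `y² + U²` exists by the constraint, and `(x - ψ / 2)' → -(3/2) E` with
`x - ψ / 2` bounded forces `E = 0`. -/
theorem tendsto_sq_add_sq (h : IsReducedSolution x y U n v) :
    Tendsto (fun t => y t ^ 2 + U t ^ 2) atTop (𝓝 0) := by
  obtain ⟨m, hm⟩ := h.exists_tendsto_nv
  have hx := h.tendsto_monotoneFun_and_x.2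
  have hn := h.tendsto_n
  have hψ := h.tendsto_averagingCorrection
  obtain ⟨E, hE⟩ : ∃ E, Tendsto (fun t => y t ^ 2 + U t ^ 2) atTop (𝓝 E) := by
    refine ⟨_, ((((hx.pow 2).const_sub 1).sub ((hn.pow 2).const_mul (3 / 4))).sub
      (hm.const_mul (3 / 2))).congr fun t => ?_⟩
    linear_combination -(h.constraint t)
  -- bounded quantities times quantities tending to zero
  have hy2 : ∀ {f : ℝ → ℝ}, Tendsto f atTop (𝓝 0) →
      Tendsto (fun t => f t * y t ^ 2) atTop (𝓝 0) := fun hf =>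
    hf.zero_mul_isBoundedUnder_le (isBoundedUnder_of ⟨1, fun t => by
      simpa using h.abs_y_le t⟩)
  have hU2 : ∀ {f : ℝ → ℝ}, Tendsto f atTop (𝓝 0) →
      Tendsto (fun t => f t * U t ^ 2) atTop (𝓝 0) := fun hf =>
    hf.zero_mul_isBoundedUnder_le (isBoundedUnder_of ⟨1, fun t => by
      simpa using h.abs_U_le t⟩)
  have hlim : Tendsto (fun t => (1 - x t ^ 2 - y t ^ 2 - 3 * U t ^ 2 + 9 / 4 * n t ^ 2
      - (2 - whQ (x t) (y t)) * x t) -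
      1 / 2 * (averagingCorrection y U v t
        * (whQ (x t) (y t) - 2 - 4 * averagingCorrection y U v t)
        + 3 * (y t ^ 2 - U t ^ 2) - 3 * U t ^ 2 * (n t / v t))) atTop (𝓝 (-(3 / 2) * E)) := by
    have hnv : Tendsto (fun t => n t / v t) atTop (𝓝 0) := by
      simpa [div_eq_mul_inv] using hn.mul h.tendsto_inv_v
    have a1 : Tendsto (fun t => (1 - 2 * x t) * (1 - x t ^ 2)) atTop (𝓝 0) := by
      have := ((hx.const_mul 2).const_sub 1).mul ((hx.pow 2).const_sub 1)
      norm_num at this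
      simpa using this
    have a2 : Tendsto (fun t => (2 * x t - 1) * y t ^ 2) atTop (𝓝 0) := by
      refine hy2 ?_
      have := (hx.const_mul 2).sub_const 1
      norm_num at this
      exact this
    have a3 : Tendsto (fun t => averagingCorrection y U v t
        * (2 * x t ^ 2 - 2 - 4 * averagingCorrection y U v t)) atTop (𝓝 0) := by
      simpa using hψ.mul ((((hx.pow 2).const_mul 2).sub_const 2).sub (hψ.const_mul 4))
    have a4 := hy2 hψ
    have a5 := hU2 hnv
    have := (((((hE.const_mul (-(3 / 2))).add a1).add a2).sub (a3.const_mul (1 / 2))).sub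
      a4).add ((a5.const_mul (3 / 2)).add ((hn.pow 2).const_mul (9 / 4)))
    simp only [mul_zero, add_zero, sub_zero, ne_eq, OfNat.ofNat_ne_zero, not_false_eq_true,
      zero_pow] at this
    refine this.congr fun t => ?_
    unfold whQ
    ring
  have hder := fun t => (h.deriv_x' t).sub ((h.deriv_averagingCorrection t).const_mul (1 / 2))
  obtain ⟨k, hk0, hk⟩ := h.exists_inv_v_le 0
  have hB : ∀ t, 0 ≤ t → |x t - 1 / 2 * averagingCorrection y U v t| ≤ 1 + k := fun t ht => by
    have h1 := (h.abs_averagingCorrection_le t).trans (hk t ht)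
    refine (abs_sub _ _).trans (add_le_add (h.abs_x_le t) ?_)
    rw [abs_mul, abs_of_pos (by norm_num : (0 : ℝ) < 1 / 2)]
    linarith [abs_nonneg (averagingCorrection y U v t)]
  have h2 := nonpos_of_tendsto_deriv_of_bddAbove (t₀ := 0) (B := 1 + k) (fun t _ => (hder t).neg)
    (fun t ht => by
      have := (abs_le.1 (hB t ht)).1
      simp only [Pi.neg_apply, Pi.sub_apply]
      linarith) hlim.neg
  have hE0 : E = 0 :=
    le_antisymm (by linarith) (ge_of_tendsto' hE fun t => by positivity)
  rwa [hE0] at hE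

theorem tendsto_y (h : IsReducedSolution x y U n v) : Tendsto y atTop (𝓝 0) := by
  refine squeeze_zero_norm (fun t => ?_) (by simpa using h.tendsto_sq_add_sq.sqrt)
  exact Real.abs_le_sqrt (by nlinarith [sq_nonneg (U t)])

theorem tendsto_U (h : IsReducedSolution x y U n v) : Tendsto U atTop (𝓝 0) := by
  refine squeeze_zero_norm (fun t => ?_) (by simpa using h.tendsto_sq_add_sq.sqrt)
  exact Real.abs_le_sqrt (by nlinarith [sq_nonneg (y t)])

theorem tendsto_nv (h : IsReducedSolution x y U n v) :
    Tendsto (fun t => n t * v t) atTop (𝓝 (1 / 2)) := by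
  have hx := h.tendsto_monotoneFun_and_x.2
  have := ((((hx.pow 2).const_sub 1).sub h.tendsto_sq_add_sq).sub
    ((h.tendsto_n.pow 2).const_mul (3 / 4))).const_mul (2 / 3)
  norm_num at this
  refine this.congr fun t => ?_
  linear_combination (-2 / 3) * h.constraint t

end IsReducedSolution

/-! ### Back to the Wainwright–Hsu variables -/

theorem IsWainwrightHsuSolution.isReducedSolution {Sp Sm N1 N2 N3 : ℝ → ℝ}
    (hsol : IsWainwrightHsuSolution Sp Sm N1 N2 N3)
    {τ₀ : ℝ} (hN1 : N1 τ₀ < 0) (hN2 : 0 < N2 τ₀) (hN3 : 0 < N3 τ₀) :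
    IsReducedSolution Sp Sm (fun t => Real.sqrt 3 / 2 * (N2 t - N3 t)) (fun t => -N1 t)
      (fun t => N2 t + N3 t) := by
  have hp : Continuous Sp := continuous_iff_continuousAt.2 fun t => (hsol.deriv_Sp t).continuousAt
  have hm : Continuous Sm := continuous_iff_continuousAt.2 fun t => (hsol.deriv_Sm t).continuousAt
  have h1 : ∀ t, N1 t < 0 := fun t => by
    rw [eq_mul_exp_integral_of_hasDerivAt (by unfold whQ; fun_prop) hsol.deriv_N1 τ₀ t]
    exact mul_neg_of_neg_of_pos hN1 (Real.exp_pos _)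
  have h2 : ∀ t, 0 < N2 t := fun t => by
    rw [eq_mul_exp_integral_of_hasDerivAt (by unfold whQ; fun_prop) hsol.deriv_N2 τ₀ t]
    exact mul_pos hN2 (Real.exp_pos _)
  have h3 : ∀ t, 0 < N3 t := fun t => by
    rw [eq_mul_exp_integral_of_hasDerivAt (by unfold whQ; fun_prop) hsol.deriv_N3 τ₀ t]
    exact mul_pos hN3 (Real.exp_pos _)
  have s3 : Real.sqrt 3 ^ 2 = 3 := Real.sq_sqrt (by norm_num)
  refine ⟨fun t => ?_, fun t => ?_, fun t => ?_, fun t => ?_, fun t => ?_, fun t => ?_,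
    fun t => neg_pos.2 (h1 t), fun t => add_pos (h2 t) (h3 t), fun t => ?_⟩
  · refine (hsol.deriv_N1 t).neg.congr_deriv ?_
    ring
  · refine ((hsol.deriv_N2 t).add (hsol.deriv_N3 t)).congr_deriv ?_
    ring
  · refine (((hsol.deriv_N2 t).sub (hsol.deriv_N3 t)).const_mul (Real.sqrt 3 / 2)).congr_deriv ?_
    linear_combination Sm t * (N2 t + N3 t) * s3
  · refine (hsol.deriv_Sp t).congr_deriv ?_
    unfold whSPlus
    linear_combination (1 / 2) * (N2 t - N3 t) ^ 2 * s3
  · refine (hsol.deriv_Sm t).congr_deriv ?_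
    unfold whSMinus
    ring
  · linear_combination hsol.constraint t + (1 / 4) * (N2 t - N3 t) ^ 2 * s3
  · have := mul_pos (h2 t) (h3 t)
    have e : (Real.sqrt 3 / 2 * (N2 t - N3 t)) ^ 2 = 3 / 4 * (N2 t - N3 t) ^ 2 := by
      linear_combination (1 / 4) * (N2 t - N3 t) ^ 2 * s3
    simp only [e]
    nlinarith

theorem mainTheorem1 (Sp Sm N1 N2 N3 : ℝ → ℝ)
    (hsol : IsWainwrightHsuSolution Sp Sm N1 N2 N3)
    (τ₀ : ℝ) (hN1 : N1 τ₀ < 0) (hN2 : 0 < N2 τ₀) (hN3 : 0 < N3 τ₀) :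
    Tendsto N1 atTop (𝓝 0) ∧
    Tendsto N2 atTop atTop ∧
    Tendsto N3 atTop atTop ∧
    Tendsto Sp atTop (𝓝 (1 / 2)) ∧
    Tendsto Sm atTop (𝓝 0) ∧
    Tendsto (fun τ => N1 τ * (N2 τ + N3 τ)) atTop (𝓝 (-1 / 2)) ∧
    Tendsto (fun τ => N2 τ - N3 τ) atTop (𝓝 0) := by
  have h := hsol.isReducedSolution hN1 hN2 hN3
  have s3 : Real.sqrt 3 ≠ 0 := by positivity
  have hu : Tendsto (fun τ => N2 τ - N3 τ) atTop (𝓝 0) := by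
    have := h.tendsto_U.const_mul (2 / Real.sqrt 3)
    rw [mul_zero] at this
    refine this.congr fun t => ?_
    field_simp
  refine ⟨?_, ?_, ?_, h.tendsto_monotoneFun_and_x.2, h.tendsto_y, ?_, hu⟩
  · simpa using h.tendsto_n.neg
  · refine ((h.tendsto_v.atTop_add hu).atTop_div_const two_pos).congr fun t => ?_
    ring
  · refine ((h.tendsto_v.atTop_add hu.neg).atTop_div_const two_pos).congr fun t => ?_
    ring
  · have := h.tendsto_nv.neg
    rw [← neg_div] at this
    refine this.congr fun t => ?_
    ring
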